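/- Let $m\ge 1$ and let $C=[C_{i,j}]$ be a symmetric $m\times m$ matrix of non-negative integers (the matrix of a symmetric quiver with $m$ vertices). Put $(q^2;q^2)_d=\prod_{k=1}^{d}(1-q^{2k})$ and consider the formal power series $$P_C(x_1,\ldots,x_m)=\sum_{d_1,\ldots,d_m\ge 0}\frac{(-q)^{\sum_{i,j=1}^m C_{i,j}d_id_j}}{(q^2;q^2)_{d_1}\cdots(q^2;q^2)_{d_m}}\,x_1^{d_1}\cdots x_m^{d_m}.$$ A set of $k\geq 1$ pairs $(i_u,j_u)$ with $1\le i_u,j_u\le m$ is called admissible if its second entries $j_1,\ldots,j_k$ are pairwise distinct and it contains no cycle, i.e. for no $n\ge1$ does it contain $n$ distinct pairs such that the second entry of each is the first entry of the next one, cyclically (in particular it contains no pair $(i,i)$). Let $$A_C(x_1,\ldots,x_m)=1+\sum_{k=1}^{m-1}\ \sum_{\substack{\Sigma\ \text{admissible}\\ |\Sigma|=k}}\ \prod_{(i,j)\in\Sigma}C_{i,j}\,x_i .$$ (1) The limit $$y(x_1,\ldots,x_m)=\lim_{q\to1}\frac{P_C(q^2x_1,\ldots,q^2x_m)}{P_C(x_1,\ldots,x_m)}=\sum_{l_1,\ldots,l_m\ge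 0}b_{l_1,\ldots,l_m}x_1^{l_1}\cdots x_m^{l_m}$$ exists coefficientwise, and for all $l_1,\ldots,l_m\ge 0$ $$b_{l_1,\ldots,l_m}=(-1)^{\sum_{i=1}^m(C_{i,i}+1)l_i}\,A_C(l_1,\ldots,l_m)\prod_{j=1}^m\frac{1}{1+\sum_{i=1}^mC_{i,j}l_i}\binom{1+\sum_{i=1}^mC_{i,j}l_i}{l_j}.$$ (2) $A_C$ is a polynomial of total degree at most $m-1$, with equality if the quiver is connected (i.e. the graph joining $i\ne j$ when $C_{i,j}\neq0$ is connected), and its coefficients depend only on the off-diagonal entries of $C$. (3) The family $P_m(C)=A_C$, where $m\ge1$ and $C$ runs over the symmetric $m\times m$ matrices of non-negative integers, satisfies - (A0) $P_1(C)(x)=1$; - (A1) $P_m(\sigma\circ C)(x_{\sigma_1},\ldots,x_{\sigma_m})=P_m(C)(x_1,\ldots,x_m)$ for all permutations $\sigma\in S_m$, where $[\sigma\circ C]_{i,j}=C_{\sigma_i,\sigma_j}$; - (A2) for $m\geq 2$, $P_m(C)(x_1,\ldots,x_{m-1},0)=P_{m-1}(C')(x_1,\ldots,x_{m-1})\bigl(1+\sum_{i=1}^{m-1}C_{i,m}x_i\bigr)$,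 where $C'$ is formed by the first $m-1$ rows and columns of $C$; and it is the only family of polynomials $P_m(C)\in\mathbb{Q}[x_1,\ldots,x_m]$ of total degree at most $m-1$ that satisfies (A0), (A1) and (A2). -/

import Mathlib

open Filter Topology

noncomputable section

namespace SymmetricQuiver

/-- The `q`-Pochhammer symbol `(a; q)_n = ∏_{k=0}^{n-1} (1 - a q^k)`. -/
def qPochhammer (a q : ℝ) (n : ℕ) : ℝ :=
  ∏ k ∈ Finset.range n, (1 - a * q ^ k)

/-- The motivic generating series of the quiver with matrix `C`, as a formal power series in
`x_1, …, x_m`: the coefficient of `x^d` is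
`(-q)^{∑ C_{ij} d_i d_j} / ((q²;q²)_{d_1} ⋯ (q²;q²)_{d_m})`. -/
def motivicSeries {m : ℕ} (C : Matrix (Fin m) (Fin m) ℕ) (q : ℝ) : MvPowerSeries (Fin m) ℝ :=
  fun d => (-q) ^ (∑ i, ∑ j, C i j * d i * d j) / ∏ i, qPochhammer (q ^ 2) (q ^ 2) (d i)

/-- The formal power series `P_C(q² x_1, …, q² x_m) / P_C(x_1, …, x_m)`. -/
def seriesRatio {m : ℕ} (C : Matrix (Fin m) (Fin m) ℕ) (q : ℝ) : MvPowerSeries (Fin m) ℝ :=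
  MvPowerSeries.rescale (fun _ => q ^ 2) (motivicSeries C q) * (motivicSeries C q)⁻¹

/-- A finite set of pairs contains a cycle if, for some length `n + 1 ≥ 1`, it contains distinct
pairs `p_0, …, p_n` such that the second entry of each is the first entry of the next one,
cyclically (addition in `Fin (n + 1)` wraps around). -/
def HasCycle {m : ℕ} (S : Finset (Fin m × Fin m)) : Prop :=
  ∃ (n : ℕ) (p : Fin (n + 1) → Fin m × Fin m),
    Function.Injective p ∧ (∀ t, p t ∈ S) ∧ ∀ t, (p t).2 = (p (t + 1)).1

/-- A set of pairs is admissible if the second entries are distinct and it contains no cycle. -/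
def Admissible {m : ℕ} (S : Finset (Fin m × Fin m)) : Prop :=
  (∀ p ∈ S, ∀ p' ∈ S, p.2 = p'.2 → p = p') ∧ ¬ HasCycle S

open Classical in
/-- The admissible sets consisting of exactly `k` pairs. -/
def admissibleSets (m k : ℕ) : Finset (Finset (Fin m × Fin m)) :=
  (Finset.powersetCard k Finset.univ).filter Admissible

/-- The polynomial `A = 1 + ∑_{k=1}^{m-1} ∑_{Σ admissible, |Σ| = k} ∏_{(i,j) ∈ Σ} C_{ij} x_i`. -/
def forestPolynomial {m : ℕ} (C : Matrix (Fin m) (Fin m) ℕ) : MvPolynomial (Fin m) ℚ :=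
  1 + ∑ k ∈ Finset.Icc 1 (m - 1), ∑ S ∈ admissibleSets m k,
    ∏ p ∈ S, MvPolynomial.C (C p.1 p.2 : ℚ) * MvPolynomial.X p.1

/-- The conditions (A0), (A1), (A2) on a family of polynomials `P_m(C)(x_1, …, x_m)`, where `m ≥ 1`
and `C` is a symmetric `m × m` matrix of non-negative integers. The value at `m = 0` is
irrelevant. -/
structure SatisfiesAxioms
    (P : ∀ m : ℕ, Matrix (Fin m) (Fin m) ℕ → MvPolynomial (Fin m) ℚ) : Prop where
  /-- `P_1(C)(x) = 1`. -/
  A0 : ∀ C : Matrix (Fin 1) (Fin 1) ℕ, P 1 C = 1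
  /-- `P_m(σ ∘ C)(x_{σ 1}, …, x_{σ m}) = P_m(C)(x_1, …, x_m)`, where
  `(σ ∘ C)_{ij} = C_{σ i, σ j}`. -/
  A1 : ∀ m : ℕ, 1 ≤ m → ∀ C : Matrix (Fin m) (Fin m) ℕ, C.IsSymm → ∀ σ : Equiv.Perm (Fin m),
    MvPolynomial.rename σ (P m (C.submatrix σ σ)) = P m C
  /-- `P_{m+1}(C)(x_1, …, x_m, 0) = P_m(C')(x_1, …, x_m) (1 + ∑_{i ≤ m} C_{i,m+1} x_i)`, where `C'`
  is formed by the first `m` rows and columns of `C`. -/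
  A2 : ∀ m : ℕ, 1 ≤ m → ∀ C : Matrix (Fin (m + 1)) (Fin (m + 1)) ℕ, C.IsSymm →
    MvPolynomial.aeval
        (Fin.snoc (α := fun _ => MvPolynomial (Fin m) ℚ) MvPolynomial.X 0) (P (m + 1) C) =
      P m (C.submatrix Fin.castSucc Fin.castSucc) *
        (1 + ∑ i : Fin m,
          MvPolynomial.C (C i.castSucc (Fin.last m) : ℚ) * MvPolynomial.X i)

/-- The simple graph on the vertices of the quiver: distinct vertices are joined when there is at
least one arrow between them. -/
def underlyingGraph {m : ℕ} (C : Matrix (Fin m) (Fin m) ℕ) : SimpleGraph (Fin m) :=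
  SimpleGraph.fromRel (fun i j => C i j ≠ 0)

end SymmetricQuiver

end

/-!
Write `e_i` for the unit vectors and `C_i` for the rows of `C`. As `C` is symmetric,
`P(q^{2(a + e_i)} x) = P(q^{2a} x) - (-q)^{C_ii} q^{2 a_i} x_i P(q^{2(a + C_i)} x)`.
Dividing by `P(x)`, one obtains a recursion that determines all coefficients of
`P(q^{2a} x) / P(x)` from the case `a = 0`, so their limits exist and satisfy the same recursion at
`q = 1`. That recursion is solved, up to sign, by the determinant of a matrix whose `j`-th column is
linear in binomial coefficients of `(a + l C)_j`: adding `e_i` to both `a` and `l` is Pascal's rule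
in column `i`. For `a = (1, …, 1)` the binomial coefficients can be pulled out of the columns, which
leaves the determinant of the identity plus a weighted Laplacian.

This Laplacian determinant equals `A_C` by a matrix-tree theorem, for which the uniqueness in (3) is
enough. The difference of two families as in (3) vanishes, by (A2) and induction, when `x_m = 0`,
hence by (A1) when any variable is zero; so it is divisible by `x_1 ⋯ x_m`, and it has degree less
than `m`. If the quiver is connected, orienting the edges of a breadth-first spanning tree away from
its root gives a monomial of degree `m - 1` with positive coefficient.
-/

namespace SymmetricQuiver

open scoped Matrix

noncomputable section

theorem induction_add_single {ι : Type*} [Finite ι] [DecidableEq ι] {p : (ι → ℕ) → Prop}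
    (zero : p 0) (add_single : ∀ a i, p a → p (a + Pi.single i 1)) (a : ι → ℕ) : p a := by
  suffices ∀ b, p b → p (b + a) by simpa using this 0 zero
  refine Pi.single_induction (fun a => ∀ b, p b → p (b + a)) a (by simp) ?_ ?_
  · intro a a' ha ha' b hb
    simpa only [add_assoc] using ha' _ (ha b hb)
  · intro i n b hb
    induction n with
    | zero => simpa using hb
    | succ n ih => simpa only [Pi.single_add, add_assoc] using add_single _ i ih

theorem natCast_add_single {ι R : Type*} [DecidableEq ι] [AddMonoidWithOne R] (x : ι → ℕ) (i : ι) :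
    (fun j => ((x + Pi.single i 1 : ι → ℕ) j : R)) = (fun j => (x j : R)) + Pi.single i 1 := by
  ext j
  rcases eq_or_ne j i with rfl | hj
  · simp
  · simp [hj]

theorem natCast_vecMul {ι R : Type*} [Fintype ι] [Semiring R] (C : Matrix ι ι ℕ) (l : ι → ℕ) :
    (fun j => ((l ᵥ* C) j : R)) = (fun i => (l i : R)) ᵥ* C.map (Nat.cast : ℕ → R) := by
  ext j
  simp [Matrix.vecMul, dotProduct]

section FormalDeterminants

variable {ι R : Type*} [Fintype ι] [DecidableEq ι]

/-- The coefficient of `u ^ k` in the binomial series `u * (1 + u) ^ (x - 1)`, that is,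
`(x - 1).choose (k - 1)` with the convention that it vanishes for `k = 0`. -/
def choosePred [Ring R] [BinomialRing R] (x : R) : ℕ → R
  | 0 => 0
  | k + 1 => Ring.choose (x - 1) k

theorem choosePred_succ_succ [Ring R] [BinomialRing R] (x : R) (k : ℕ) :
    choosePred (x + 1) (k + 1) = choosePred x (k + 1) + choosePred x k := by
  rcases k with _ | k
  · simp [choosePred]
  · simpa [choosePred, add_comm] using Ring.choose_succ_succ (x - 1) k

theorem natCast_mul_choose [Ring R] [BinomialRing R] (x : R) (k : ℕ) :
    k * Ring.choose x k = x * choosePred x k := by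
  rcases k with _ | k
  · simp [choosePred]
  · simpa [choosePred] using Ring.choose_smul_choose x (Nat.le_add_left 1 k)

/-- The matrix with columns `(x j).choose (l j) • e_j - choosePred (x j) (l j) • K_j`, where `K_j`
is the `j`-th column of `K`. For `x = a + l ᵥ* C` its determinant is, up to sign, the coefficient of
`X ^ l` in the limit of `P_C(q ^ (2 a) X) / P_C(X)` as `q` tends to `1`. -/
def binomialMatrix [CommRing R] [BinomialRing R] (K : Matrix ι ι R) (x : ι → R) (l : ι → ℕ) :
    Matrix ι ι R :=
  Matrix.diagonal (fun j => Ring.choose (x j) (l j)) -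
    K * Matrix.diagonal (fun j => choosePred (x j) (l j))

theorem binomialMatrix_apply [CommRing R] [BinomialRing R] (K : Matrix ι ι R) (x : ι → R)
    (l : ι → ℕ) (i j : ι) :
    binomialMatrix K x l i j =
      (1 : Matrix ι ι R) i j * Ring.choose (x j) (l j) - K i j * choosePred (x j) (l j) := by
  rcases eq_or_ne i j with rfl | h
  · simp [binomialMatrix]
  · simp [binomialMatrix, h]

theorem binomialMatrix_zero [CommRing R] [BinomialRing R] (K : Matrix ι ι R) (x : ι → R) :
    binomialMatrix K x 0 = 1 := by
  ext i j
  simp [binomialMatrix_apply, choosePred]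

theorem binomialMatrix_add_single_of_eq_zero [CommRing R] [BinomialRing R] (K : Matrix ι ι R)
    (x : ι → R) {l : ι → ℕ} {i : ι} (hi : l i = 0) :
    binomialMatrix K (x + Pi.single i 1) l = binomialMatrix K x l := by
  ext r j
  rcases eq_or_ne j i with rfl | hj
  · simp [binomialMatrix_apply, hi, choosePred]
  · simp [binomialMatrix_apply, hj]

/- Pascal's rule holds in column `i`, and the three matrices agree in all other columns. -/
theorem det_binomialMatrix_add_single [CommRing R] [BinomialRing R] (K : Matrix ι ι R)
    (x : ι → R) (l : ι → ℕ) (i : ι) :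
    (binomialMatrix K (x + Pi.single i 1) (l + Pi.single i 1)).det =
      (binomialMatrix K x (l + Pi.single i 1)).det + (binomialMatrix K x l).det := by
  have pascal : binomialMatrix K (x + Pi.single i 1) (l + Pi.single i 1) =
      (binomialMatrix K x l).updateCol i
        ((binomialMatrix K x (l + Pi.single i 1)).col i + (binomialMatrix K x l).col i) := by
    ext r j
    rcases eq_or_ne j i with rfl | hj
    · simp only [binomialMatrix_apply, Pi.add_apply, Pi.single_eq_same, Ring.choose_succ_succ,
        choosePred_succ_succ, Matrix.updateCol_self, Matrix.col_apply]
      ring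
    · simp [binomialMatrix_apply, hj]
  have agree : (binomialMatrix K x l).updateCol i
      ((binomialMatrix K x (l + Pi.single i 1)).col i) =
        binomialMatrix K x (l + Pi.single i 1) := by
    ext r j
    rcases eq_or_ne j i with rfl | hj
    · simp
    · simp [binomialMatrix_apply, hj]
  rw [pascal, Matrix.det_updateCol_add, agree]
  congr 2
  exact Matrix.updateCol_eq_self _ _

theorem vecMul_binomialMatrix [CommRing R] [BinomialRing R] (K : Matrix ι ι R) (l : ι → ℕ) :
    (fun i => (l i : R)) ᵥ* binomialMatrix K ((fun i => (l i : R)) ᵥ* K) l = 0 := by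
  ext j
  simp [binomialMatrix, Matrix.vecMul_sub, ← Matrix.vecMul_vecMul, Matrix.vecMul_diagonal,
    natCast_mul_choose]

theorem det_binomialMatrix_vecMul [CommRing R] [BinomialRing R] [IsDomain R] [CharZero R]
    (K : Matrix ι ι R) {l : ι → ℕ} (hl : l ≠ 0) :
    (binomialMatrix K ((fun i => (l i : R)) ᵥ* K) l).det = 0 :=
  Matrix.exists_vecMul_eq_zero_iff.1
    ⟨_, fun h => hl (funext fun i => by simpa using congrFun h i), vecMul_binomialMatrix K l⟩

theorem det_binomialMatrix_of_ne_zero {F : Type*} [Field F] [BinomialRing F] (K : Matrix ι ι F)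
    {x : ι → F} (hx : ∀ j, x j ≠ 0) (l : ι → ℕ) :
    (binomialMatrix K x l).det =
      (Matrix.diagonal x - K * Matrix.diagonal (fun j => (l j : F))).det *
        ∏ j, 1 / x j * Ring.choose (x j) (l j) := by
  rw [← Matrix.det_diagonal, ← Matrix.det_mul]
  congr 1
  ext i j
  have h : choosePred (x j) (l j) = l j * (1 / x j * Ring.choose (x j) (l j)) := by
    rw [mul_left_comm, natCast_mul_choose, one_div, inv_mul_cancel_left₀ (hx j)]
  rw [binomialMatrix_apply, Matrix.mul_diagonal, Matrix.sub_apply, Matrix.mul_diagonal, h,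
    Matrix.diagonal_apply, Matrix.one_apply]
  split_ifs with hij
  · subst hij
    field_simp [hx i]
  · ring

/-- The identity plus the Laplacian of the directed graph on `ι` with weight `x i * K i j` on the
arrow `i → j`; loops cancel on the diagonal. -/
def forestMatrix [CommRing R] (K : Matrix ι ι R) (x : ι → R) : Matrix ι ι R :=
  Matrix.diagonal (1 + x ᵥ* K) - Matrix.diagonal x * K

theorem forestMatrix_apply [CommRing R] (K : Matrix ι ι R) (x : ι → R) (i j : ι) :
    forestMatrix K x i j = (if i = j then 1 + ∑ k, x k * K k j else 0) - x i * K i j := by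
  simp only [forestMatrix, Matrix.sub_apply, Matrix.diagonal_apply, Matrix.diagonal_mul]
  split_ifs with h
  · subst h; rfl
  · rfl

theorem one_vecMul_forestMatrix [CommRing R] (K : Matrix ι ι R) (x : ι → R) :
    1 ᵥ* forestMatrix K x = 1 := by
  have h : (1 : ι → R) ᵥ* Matrix.diagonal x = x := by
    ext i
    simp [Matrix.vecMul_diagonal]
  ext j
  simp [forestMatrix, Matrix.vecMul_sub, ← Matrix.vecMul_vecMul, Matrix.vecMul_diagonal, h]

theorem transpose_forestMatrix [CommRing R] {K : Matrix ι ι R} (hK : K.IsSymm) (x : ι → R) :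
    (forestMatrix K x)ᵀ = Matrix.diagonal (1 + x ᵥ* K) - K * Matrix.diagonal x := by
  simp [forestMatrix, hK.eq]

theorem map_forestMatrix {S : Type*} [CommRing R] [CommRing S] (f : R →+* S) (K : Matrix ι ι R)
    (x : ι → R) : (forestMatrix K x).map f = forestMatrix (K.map f) (f ∘ x) := by
  ext i j
  simp [forestMatrix_apply, apply_ite f]

theorem submatrix_forestMatrix {κ : Type*} [Fintype κ] [DecidableEq κ] [CommRing R]
    (K : Matrix ι ι R) (x : ι → R) (e : κ ≃ ι) :
    (forestMatrix K x).submatrix e e = forestMatrix (K.submatrix e e) (x ∘ e) := by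
  ext i j
  simp [forestMatrix_apply, ← e.sum_comp fun k => x k * K k (e j)]

theorem det_forestMatrix_snoc [CommRing R] {m : ℕ} (K : Matrix (Fin (m + 1)) (Fin (m + 1)) R)
    (x : Fin m → R) :
    (forestMatrix K (Fin.snoc (α := fun _ => R) x 0)).det =
      (forestMatrix (K.submatrix Fin.castSucc Fin.castSucc) x).det *
        (1 + ∑ i, K i.castSucc (Fin.last m) * x i) := by
  set M := forestMatrix K (Fin.snoc (α := fun _ => R) x 0)
  have last_row (i : Fin m) : M (Fin.last m) i.castSucc = 0 := by
    simp [M, forestMatrix_apply, (Fin.castSucc_lt_last i).ne']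
  have corner : M (Fin.last m) (Fin.last m) = 1 + ∑ i, K i.castSucc (Fin.last m) * x i := by
    simp [M, forestMatrix_apply, Fin.sum_univ_castSucc, mul_comm]
  have minor : M.submatrix Fin.castSucc Fin.castSucc =
      forestMatrix (K.submatrix Fin.castSucc Fin.castSucc) x := by
    ext i j
    simp [M, forestMatrix_apply, Fin.sum_univ_castSucc]
  rw [Matrix.det_succ_row _ (Fin.last m), Fin.sum_univ_castSucc,
    Finset.sum_eq_zero fun i _ => by rw [last_row, mul_zero, zero_mul], zero_add, corner]
  simp [minor, mul_comm]

theorem det_updateRow_one_of_one_vecMul_eq_one [CommRing R] {M : Matrix ι ι R}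
    (hM : 1 ᵥ* M = 1) (r : ι) : (M.updateRow r 1).det = M.det := by
  have h := Matrix.det_updateRow_sum M r 1
  rwa [← Matrix.vecMul_eq_sum, hM, Pi.one_apply, one_smul] at h

theorem totalDegree_det_le {σ : Type*} [CommRing R] {M : Matrix ι ι (MvPolynomial σ R)}
    {d : ι → ℕ} (hM : ∀ i j, (M i j).totalDegree ≤ d i) : M.det.totalDegree ≤ ∑ i, d i := by
  rw [Matrix.det_apply]
  refine MvPolynomial.totalDegree_finsetSum_le fun σ _ => ?_
  calc (Equiv.Perm.sign σ • ∏ i, M (σ i) i).totalDegree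
      ≤ (∏ i, M (σ i) i).totalDegree := MvPolynomial.totalDegree_smul_le _ _
    _ ≤ ∑ i, (M (σ i) i).totalDegree := MvPolynomial.totalDegree_finsetProd _ _
    _ ≤ ∑ i, d (σ i) := Finset.sum_le_sum fun i _ => hM _ _
    _ = ∑ i, d i := Equiv.sum_comp σ d

/-- The generating polynomial of rooted forests on the weighted directed graph `K`, in its
determinantal form. -/
def forestDet [CommRing R] (K : Matrix ι ι R) : MvPolynomial ι R :=
  (forestMatrix (K.map MvPolynomial.C) MvPolynomial.X).det

theorem aeval_forestDet {S : Type*} [CommRing R] [CommRing S] [Algebra R S] (K : Matrix ι ι R)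
    (x : ι → S) :
    MvPolynomial.aeval x (forestDet K) = (forestMatrix (K.map (algebraMap R S)) x).det := by
  rw [forestDet, AlgHom.map_det]
  congr 1
  have h := map_forestMatrix (MvPolynomial.aeval (R := R) x).toRingHom (K.map MvPolynomial.C)
    MvPolynomial.X
  refine h.trans ?_
  congr 1
  · ext i j
    simp
  · ext i
    simp

theorem eval_forestDet [CommRing R] (K : Matrix ι ι R) (x : ι → R) :
    MvPolynomial.eval x (forestDet K) = (forestMatrix K x).det :=
  aeval_forestDet K x

theorem rename_forestDet {κ : Type*} [Fintype κ] [DecidableEq κ] [CommRing R] (K : Matrix ι ι R)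
    (e : κ ≃ ι) : MvPolynomial.rename e (forestDet (K.submatrix e e)) = forestDet K := by
  have h : MvPolynomial.rename (R := R) e = MvPolynomial.aeval (MvPolynomial.X ∘ e) :=
    MvPolynomial.algHom_ext fun i => by simp
  rw [h, aeval_forestDet, forestDet, ← Matrix.det_submatrix_equiv_self e, submatrix_forestMatrix]
  rfl

theorem totalDegree_forestMatrix_le [CommRing R] (K : Matrix ι ι R) (i j : ι) :
    (forestMatrix (K.map MvPolynomial.C) MvPolynomial.X i j).totalDegree ≤ 1 := by
  have h (k : ι) : (MvPolynomial.X k * MvPolynomial.C (K k j)).totalDegree ≤ 1 := by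
    rw [mul_comm, MvPolynomial.C_mul_X_eq_monomial]
    exact (MvPolynomial.totalDegree_monomial_le _ _).trans (by simp)
  rw [forestMatrix_apply]
  refine (MvPolynomial.totalDegree_sub _ _).trans (max_le ?_ (h i))
  split_ifs
  · exact (MvPolynomial.totalDegree_add _ _).trans
      (max_le (by simp) (MvPolynomial.totalDegree_finsetSum_le fun k _ => h k))
  · simp

/- The columns of the forest matrix sum to `1`, so one of its linear rows may be replaced by a
constant one. -/
theorem totalDegree_forestDet_le [CommRing R] [Nonempty ι] (K : Matrix ι ι R) :
    (forestDet K).totalDegree ≤ Fintype.card ι - 1 := by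
  obtain ⟨r⟩ := ‹Nonempty ι›
  rw [forestDet, ← det_updateRow_one_of_one_vecMul_eq_one (one_vecMul_forestMatrix _ _) r]
  refine (totalDegree_det_le (d := Function.update 1 r 0) fun i j => ?_).trans_eq ?_
  · rcases eq_or_ne i r with rfl | hi
    · simp
    · simpa [hi] using totalDegree_forestMatrix_le K i j
  · simp [Finset.sum_update_of_mem, Finset.card_sdiff]

end FormalDeterminants

section ShiftedSeries

variable {σ R : Type*} [CommSemiring R]

/-- The substitution `X i ↦ q ^ (2 * a i) * X i` in a power series. -/
def qShift (q : R) (a : σ → ℕ) : MvPowerSeries σ R →+* MvPowerSeries σ R :=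
  MvPowerSeries.rescale fun i => q ^ (2 * a i)

theorem qShift_zero (q : R) : qShift q (0 : σ → ℕ) = RingHom.id _ := by
  rw [← MvPowerSeries.rescale_one]
  exact congrArg MvPowerSeries.rescale (funext fun _ => pow_zero q)

theorem qShift_add (q : R) (a b : σ → ℕ) : qShift q (a + b) = (qShift q a).comp (qShift q b) := by
  rw [qShift, qShift, qShift, ← MvPowerSeries.rescale_mul]
  congr 1
  ext i
  simp only [Pi.add_apply, Pi.mul_apply]
  ring

theorem coeff_qShift [Fintype σ] (q : R) (a : σ → ℕ) (d : σ →₀ ℕ) (f : MvPowerSeries σ R) :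
    MvPowerSeries.coeff d (qShift q a f) = q ^ (2 * a ⬝ᵥ d) * MvPowerSeries.coeff d f := by
  rw [qShift, MvPowerSeries.coeff_rescale, Finsupp.prod_fintype _ _ fun _ => pow_zero _,
    dotProduct, Finset.mul_sum, ← Finset.prod_pow_eq_pow_sum]
  simp only [← pow_mul, mul_assoc]

theorem qShift_monomial_single (q : R) (a : σ → ℕ) (i : σ) (c : R) :
    qShift q a (MvPowerSeries.monomial (Finsupp.single i 1) c) =
      MvPowerSeries.monomial (Finsupp.single i 1) (q ^ (2 * a i) * c) := by
  classical
  ext d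
  rw [qShift, MvPowerSeries.coeff_rescale, MvPowerSeries.coeff_monomial,
    MvPowerSeries.coeff_monomial]
  split_ifs with h
  · simp [h, Finsupp.prod_single_index]
  · exact mul_zero _

theorem quadraticForm_add_single [Fintype σ] [DecidableEq σ] {M : Matrix σ σ R} (hM : M.IsSymm)
    (d : σ → R) (i : σ) :
    ∑ r, ∑ j, M r j * (d + Pi.single i 1 : σ → R) r * (d + Pi.single i 1 : σ → R) j =
      ∑ r, ∑ j, M r j * d r * d j + M i i + 2 * M.row i ⬝ᵥ d := by
  have h (r : σ) : M r i = M i r := hM.apply i r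
  simp only [Pi.add_apply, Pi.single_apply, mul_add, add_mul, Finset.sum_add_distrib, dotProduct,
    Matrix.row_apply, mul_ite, ite_mul, mul_one, mul_zero, zero_mul, Finset.sum_ite_eq',
    Finset.mem_univ, if_true, Finset.sum_ite_irrel, Finset.sum_const_zero, h]
  ring

end ShiftedSeries

section Ratios

variable {m : ℕ}

theorem prod_qPochhammer_add_single (a q : ℝ) (d : Fin m → ℕ) (i : Fin m) :
    ∏ j, qPochhammer a q ((d + Pi.single i 1 : Fin m → ℕ) j) =
      (1 - a * q ^ d i) * ∏ j, qPochhammer a q (d j) := by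
  have h (j : Fin m) : qPochhammer a q ((d + Pi.single i 1 : Fin m → ℕ) j) =
      (if j = i then 1 - a * q ^ d i else 1) * qPochhammer a q (d j) := by
    rcases eq_or_ne j i with rfl | hj
    · simp [qPochhammer, Finset.prod_range_succ, mul_comm]
    · simp [hj]
  simp only [h, Finset.prod_mul_distrib, Finset.prod_ite_eq', Finset.mem_univ, if_true]

theorem coeff_motivicSeries (C : Matrix (Fin m) (Fin m) ℕ) (q : ℝ) (d : Fin m →₀ ℕ) :
    MvPowerSeries.coeff d (motivicSeries C q) =
      (-q) ^ (∑ i, ∑ j, C i j * d i * d j) / ∏ i, qPochhammer (q ^ 2) (q ^ 2) (d i) :=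
  rfl

theorem constantCoeff_motivicSeries (C : Matrix (Fin m) (Fin m) ℕ) (q : ℝ) :
    MvPowerSeries.constantCoeff (motivicSeries C q) = 1 := by
  simp [← MvPowerSeries.coeff_zero_eq_constantCoeff_apply, coeff_motivicSeries, qPochhammer]

theorem coeff_add_single_motivicSeries {C : Matrix (Fin m) (Fin m) ℕ} (hC : C.IsSymm) {q : ℝ}
    (hq : q ^ 2 ≠ 1) (d : Fin m →₀ ℕ) (i : Fin m) :
    (1 - q ^ (2 * (d i + 1))) *
        MvPowerSeries.coeff (Finsupp.single i 1 + d) (motivicSeries C q) =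
      (-q) ^ C i i * q ^ (2 * C.row i ⬝ᵥ d) * MvPowerSeries.coeff d (motivicSeries C q) := by
  have hne : 1 - q ^ 2 * (q ^ 2) ^ d i ≠ 0 := by
    rw [← pow_succ', sub_ne_zero]
    exact fun h => hq ((pow_eq_one_iff_of_nonneg (sq_nonneg q) (d i).succ_ne_zero).1 h.symm)
  have form := quadraticForm_add_single hC d i
  rw [coeff_motivicSeries, coeff_motivicSeries, add_comm _ d, Finsupp.coe_add,
    Finsupp.single_eq_pi_single, form, prod_qPochhammer_add_single, pow_mul q, pow_succ', pow_add,
    pow_add, pow_mul (-q), neg_sq, pow_mul q, mul_div_assoc', mul_div_mul_left _ _ hne]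
  ring

theorem qShift_single_motivicSeries {C : Matrix (Fin m) (Fin m) ℕ} (hC : C.IsSymm) {q : ℝ}
    (hq : q ^ 2 ≠ 1) (i : Fin m) :
    qShift q (Pi.single i 1) (motivicSeries C q) =
      motivicSeries C q - MvPowerSeries.monomial (Finsupp.single i 1) ((-q) ^ C i i) *
        qShift q (C.row i) (motivicSeries C q) := by
  ext d
  rw [map_sub, coeff_qShift, single_one_dotProduct]
  rcases Nat.eq_zero_or_pos (d i) with hd | hd
  · simp [MvPowerSeries.coeff_monomial_mul, hd]
  · obtain ⟨e, rfl⟩ : ∃ e, d = Finsupp.single i 1 + e :=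
      exists_add_of_le (Finsupp.single_le_iff.2 hd)
    have h := coeff_add_single_motivicSeries hC hq e i
    rw [MvPowerSeries.coeff_add_monomial_mul, coeff_qShift, ← mul_assoc, ← h, Finsupp.add_apply,
      Finsupp.single_eq_same]
    ring

/-- The power series `P_C(q ^ (2 a) X) / P_C(X)`. -/
def shiftedRatio (C : Matrix (Fin m) (Fin m) ℕ) (q : ℝ) (a : Fin m → ℕ) :
    MvPowerSeries (Fin m) ℝ :=
  qShift q a (motivicSeries C q) * (motivicSeries C q)⁻¹

theorem shiftedRatio_zero (C : Matrix (Fin m) (Fin m) ℕ) (q : ℝ) : shiftedRatio C q 0 = 1 := by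
  rw [shiftedRatio, qShift_zero, RingHom.id_apply,
    MvPowerSeries.mul_inv_cancel _ (by simp [constantCoeff_motivicSeries])]

theorem shiftedRatio_one (C : Matrix (Fin m) (Fin m) ℕ) (q : ℝ) :
    shiftedRatio C q 1 = seriesRatio C q := by
  simp [shiftedRatio, seriesRatio, qShift]

theorem shiftedRatio_add_single {C : Matrix (Fin m) (Fin m) ℕ} (hC : C.IsSymm) {q : ℝ}
    (hq : q ^ 2 ≠ 1) (a : Fin m → ℕ) (i : Fin m) :
    shiftedRatio C q (a + Pi.single i 1) = shiftedRatio C q a -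
      MvPowerSeries.monomial (Finsupp.single i 1) (q ^ (2 * a i) * (-q) ^ C i i) *
        shiftedRatio C q (a + C.row i) := by
  simp only [shiftedRatio, qShift_add, RingHom.comp_apply, qShift_single_motivicSeries hC hq,
    map_sub, map_mul, qShift_monomial_single]
  ring

/-- For symmetric `C`, the limit of the coefficient of `X ^ l` in `P_C(q ^ (2 a) X) / P_C(X)` as `q`
tends to `1`. -/
def limitCoeff (C : Matrix (Fin m) (Fin m) ℕ) (a l : Fin m → ℕ) : ℚ :=
  (-1) ^ (∑ i, (C i i + 1) * l i) *
    (binomialMatrix (C.map (Nat.cast : ℕ → ℚ)) (fun j => ((a + l ᵥ* C) j : ℚ)) l).det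

theorem limitCoeff_zero_right (C : Matrix (Fin m) (Fin m) ℕ) (a : Fin m → ℕ) :
    limitCoeff C a 0 = 1 := by
  simp [limitCoeff, binomialMatrix_zero]

theorem limitCoeff_zero_left (C : Matrix (Fin m) (Fin m) ℕ) {l : Fin m → ℕ} (hl : l ≠ 0) :
    limitCoeff C 0 l = 0 := by
  rw [limitCoeff, zero_add, natCast_vecMul, det_binomialMatrix_vecMul _ hl, mul_zero]

theorem limitCoeff_add_single_of_eq_zero (C : Matrix (Fin m) (Fin m) ℕ) (a : Fin m → ℕ)
    {l : Fin m → ℕ} {i : Fin m} (hi : l i = 0) :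
    limitCoeff C (a + Pi.single i 1) l = limitCoeff C a l := by
  rw [limitCoeff, limitCoeff, add_right_comm, natCast_add_single,
    binomialMatrix_add_single_of_eq_zero _ _ hi]

theorem limitCoeff_add_single_add_single (C : Matrix (Fin m) (Fin m) ℕ) (a l : Fin m → ℕ)
    (i : Fin m) :
    limitCoeff C (a + Pi.single i 1) (l + Pi.single i 1) =
      limitCoeff C a (l + Pi.single i 1) - (-1) ^ C i i * limitCoeff C (a + C.row i) l := by
  have shift : a + (l + Pi.single i 1) ᵥ* C = a + C.row i + l ᵥ* C := by
    rw [Matrix.add_vecMul, Matrix.single_one_vecMul, add_assoc, add_comm (C.row i)]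
  have sign : ∑ j, (C j j + 1) * (l + Pi.single i 1 : Fin m → ℕ) j =
      ∑ j, (C j j + 1) * l j + (C i i + 1) := by
    simp only [Pi.add_apply, mul_add _ (l _), Finset.sum_add_distrib]
    simp [Pi.single_apply]
  simp only [limitCoeff]
  rw [add_right_comm, natCast_add_single, det_binomialMatrix_add_single, shift, sign]
  ring

theorem eventually_sq_ne_one : ∀ᶠ q : ℝ in 𝓝[≠] 1, q ^ 2 ≠ 1 := by
  have hpos : ∀ᶠ q : ℝ in 𝓝[≠] 1, 0 < q := nhdsWithin_le_nhds (lt_mem_nhds one_pos)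
  filter_upwards [hpos, self_mem_nhdsWithin] with q hq hq1 h
  exact hq1 ((pow_eq_one_iff_of_nonneg hq.le two_ne_zero).1 h)

theorem tendsto_coeff_shiftedRatio {C : Matrix (Fin m) (Fin m) ℕ} (hC : C.IsSymm)
    (a : Fin m → ℕ) (l : Fin m →₀ ℕ) :
    Tendsto (fun q : ℝ => MvPowerSeries.coeff l (shiftedRatio C q a)) (𝓝[≠] 1)
      (𝓝 (limitCoeff C a l : ℝ)) := by
  induction l using WellFoundedLT.induction generalizing a with | _ l ih
  induction a using induction_add_single with
  | zero =>
    rcases eq_or_ne l 0 with rfl | hl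
    · simp [shiftedRatio_zero, limitCoeff_zero_right]
    · have hl' : (l : Fin m → ℕ) ≠ 0 := fun h => hl (DFunLike.coe_injective h)
      simp [shiftedRatio_zero, limitCoeff_zero_left C hl', MvPowerSeries.coeff_one, hl]
  | add_single a i iha =>
    have hratio : ∀ᶠ q : ℝ in 𝓝[≠] 1, shiftedRatio C q (a + Pi.single i 1) =
        shiftedRatio C q a -
          MvPowerSeries.monomial (Finsupp.single i 1) (q ^ (2 * a i) * (-q) ^ C i i) *
            shiftedRatio C q (a + C.row i) :=
      eventually_sq_ne_one.mono fun q hq => shiftedRatio_add_single hC hq a i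
    refine Tendsto.congr' (hratio.mono fun q hq => (congrArg (MvPowerSeries.coeff l) hq).symm) ?_
    simp only [map_sub]
    rcases Nat.eq_zero_or_pos (l i) with hi | hi
    · simpa [MvPowerSeries.coeff_monomial_mul, hi, limitCoeff_add_single_of_eq_zero] using iha
    · obtain ⟨e, rfl⟩ : ∃ e, l = Finsupp.single i 1 + e :=
        exists_add_of_le (Finsupp.single_le_iff.2 hi)
      have hfactor : Tendsto (fun q : ℝ => q ^ (2 * a i) * (-q) ^ C i i) (𝓝[≠] 1)
          (𝓝 ((-1) ^ C i i)) := by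
        have : Continuous fun q : ℝ => q ^ (2 * a i) * (-q) ^ C i i := by fun_prop
        simpa using (this.tendsto 1).mono_left nhdsWithin_le_nhds
      have hlimit := limitCoeff_add_single_add_single C a e i
      rw [← Finsupp.single_eq_pi_single, ← Finsupp.coe_add, add_comm e] at hlimit
      have he : e < Finsupp.single i 1 + e := by simp [pos_iff_ne_zero]
      simp only [MvPowerSeries.coeff_add_monomial_mul]
      rw [← Finsupp.single_eq_pi_single, hlimit]
      push_cast
      exact iha.sub (hfactor.mul (ih e he (a + C.row i)))

end Ratios

theorem eq_zero_of_totalDegree_lt_card {σ R : Type*} [Fintype σ] [CommSemiring R]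
    {p : MvPolynomial σ R} (hp : ∀ d ∈ p.support, ∀ i, d i ≠ 0)
    (hdeg : p.totalDegree < Fintype.card σ) : p = 0 := by
  rw [← MvPolynomial.support_eq_empty, Finset.eq_empty_iff_forall_notMem]
  intro d hd
  refine hdeg.not_ge ?_
  calc Fintype.card σ = ∑ _i : σ, 1 := by simp
    _ ≤ ∑ i, d i := Finset.sum_le_sum fun i _ => Nat.one_le_iff_ne_zero.2 (hp d hd i)
    _ = d.sum fun _ n => n := (Finsupp.sum_fintype d (fun _ n => n) fun _ => rfl).symm
    _ ≤ p.totalDegree := MvPolynomial.le_totalDegree hd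

theorem aeval_snoc_X_zero {R : Type*} [CommSemiring R] (m : ℕ) :
    MvPolynomial.aeval (R := R) (Fin.snoc (α := fun _ => MvPolynomial (Fin m) R) MvPolynomial.X 0) =
      MvPolynomial.killCompl (Fin.castSucc_injective m) := by
  refine MvPolynomial.algHom_ext fun i => ?_
  refine Fin.lastCases ?_ (fun j => ?_) i
  · simp [MvPolynomial.killCompl]
  · simp [MvPolynomial.killCompl]

theorem coeff_eq_zero_of_aeval_snoc_eq_zero {R : Type*} [CommSemiring R] {m : ℕ}
    {p : MvPolynomial (Fin (m + 1)) R}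
    (hp : MvPolynomial.aeval
      (Fin.snoc (α := fun _ => MvPolynomial (Fin m) R) MvPolynomial.X 0) p = 0)
    {d : Fin (m + 1) →₀ ℕ} (hd : d (Fin.last m) = 0) : p.coeff d = 0 := by
  have hrange : (d.support : Set (Fin (m + 1))) ⊆ Set.range Fin.castSucc := by
    intro i hi
    exact Fin.exists_castSucc_eq.2 (by rintro rfl; simp [hd] at hi)
  rw [← Finsupp.mapDomain_comapDomain Fin.castSucc (Fin.castSucc_injective m) d hrange,
    ← MvPolynomial.coeff_killCompl (Fin.castSucc_injective m), ← aeval_snoc_X_zero, hp,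
    MvPolynomial.coeff_zero]

theorem SatisfiesAxioms.unique
    {P Q : ∀ m : ℕ, Matrix (Fin m) (Fin m) ℕ → MvPolynomial (Fin m) ℚ}
    (hP : SatisfiesAxioms P) (hQ : SatisfiesAxioms Q)
    (hP' : ∀ (m : ℕ) (C : Matrix (Fin m) (Fin m) ℕ), 1 ≤ m → C.IsSymm →
      (P m C).totalDegree ≤ m - 1)
    (hQ' : ∀ (m : ℕ) (C : Matrix (Fin m) (Fin m) ℕ), 1 ≤ m → C.IsSymm →
      (Q m C).totalDegree ≤ m - 1)
    (m : ℕ) (C : Matrix (Fin m) (Fin m) ℕ) (hm : 1 ≤ m) (hC : C.IsSymm) : P m C = Q m C := by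
  induction m, hm using Nat.le_induction with
  | base => rw [hP.A0, hQ.A0]
  | succ m hm ih =>
  have last_ne_zero {D : Matrix (Fin (m + 1)) (Fin (m + 1)) ℕ} (hD : D.IsSymm)
      (d : Fin (m + 1) →₀ ℕ) (hd : (P (m + 1) D - Q (m + 1) D).coeff d ≠ 0) :
      d (Fin.last m) ≠ 0 := by
    refine mt (coeff_eq_zero_of_aeval_snoc_eq_zero ?_) hd
    rw [map_sub, hP.A2 m hm D hD, hQ.A2 m hm D hD, ih _ (hD.submatrix _), sub_self]
  refine sub_eq_zero.1 (eq_zero_of_totalDegree_lt_card (fun d hd i => ?_) ?_)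
  · set σ := Equiv.swap (Fin.last m) i
    rw [MvPolynomial.mem_support_iff, ← hP.A1 _ (by omega) C hC σ, ← hQ.A1 _ (by omega) C hC σ,
      ← map_sub] at hd
    obtain ⟨e, rfl, he⟩ := MvPolynomial.coeff_rename_ne_zero _ _ _ hd
    rw [← Equiv.swap_apply_left (Fin.last m) i, Finsupp.mapDomain_apply σ.injective]
    exact last_ne_zero (hC.submatrix _) e he
  · calc (P (m + 1) C - Q (m + 1) C).totalDegree ≤ m :=
          (MvPolynomial.totalDegree_sub _ _).trans
            (max_le (hP' _ C (by omega) hC) (hQ' _ C (by omega) hC))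
      _ < Fintype.card (Fin (m + 1)) := by simp

theorem exists_cycle {α : Type*} [Finite α] [Nonempty α] (f : α → α) :
    ∃ (n : ℕ) (c : Fin (n + 1) → α), Function.Injective c ∧ ∀ t, f (c t) = c (t + 1) := by
  obtain ⟨x, hx⟩ : (Function.periodicPts f).Nonempty := by
    obtain ⟨a, b, hab, h⟩ :=
      Finite.exists_ne_map_eq_of_infinite fun n : ℕ => f^[n] (Classical.arbitrary α)
    wlog hlt : a < b generalizing a b
    · exact this b a hab.symm h.symm (by omega)
    refine ⟨f^[a] (Classical.arbitrary α), b - a, by omega, ?_⟩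
    rw [Function.IsPeriodicPt, Function.IsFixedPt, ← Function.iterate_add_apply,
      Nat.sub_add_cancel hlt.le]
    exact h.symm
  obtain ⟨n, hn⟩ := Nat.exists_eq_add_one_of_ne_zero
    (Function.minimalPeriod_pos_of_mem_periodicPts hx).ne'
  refine ⟨n, fun t => f^[t] x, fun s t hst => Fin.ext ?_, fun t => ?_⟩
  · exact Function.iterate_injOn_Iio_minimalPeriod (f := f) (x := x)
      (s.isLt.trans_eq hn.symm) (t.isLt.trans_eq hn.symm) hst
  · change f (f^[t] x) = f^[(t + 1 : Fin (n + 1))] x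
    rw [← Function.iterate_succ_apply' f, ← Function.iterate_mod_minimalPeriod_eq, hn, Fin.val_add]
    simp

section AdmissibleSets

variable {m n : ℕ} {S T : Finset (Fin m × Fin m)}

theorem hasCycle_of_forall_mem [NeZero m] {f : Fin m → Fin m} (hf : ∀ j, (f j, j) ∈ S) :
    HasCycle S := by
  obtain ⟨n, c, hc, hfc⟩ := exists_cycle f
  refine ⟨n, fun t => (c (-t + 1), c (-t)), fun s t hst => ?_, fun t => ?_, fun t => ?_⟩
  · exact neg_injective (hc (congrArg Prod.snd hst))
  · simpa only [hfc] using hf (c (-t))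
  · exact congrArg c (by abel)

theorem not_hasCycle_of_lt {α : Type*} [LinearOrder α] (rank : Fin m → α)
    (h : ∀ p ∈ S, rank p.1 < rank p.2) : ¬ HasCycle S := by
  rintro ⟨n, p, -, hS, hc⟩
  obtain ⟨t, ht⟩ := Finite.exists_max fun t => rank (p t).1
  exact (h _ (hS t)).not_ge (hc t ▸ ht (t + 1))

/- A pair whose second entry is not the first entry of a pair in `S` lies on no cycle. -/
theorem HasCycle.restrict (hS : HasCycle S)
    (h : ∀ p ∈ S, ∀ p' ∈ S, p.2 = p'.1 → p ∈ T) : HasCycle T := by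
  obtain ⟨n, p, hp, hpS, hc⟩ := hS
  exact ⟨n, p, hp, fun t => h _ (hpS t) _ (hpS (t + 1)) (hc t), hc⟩

theorem hasCycle_map (f : Fin m ↪ Fin n) : HasCycle (S.map (f.prodMap f)) ↔ HasCycle S := by
  constructor
  · rintro ⟨k, p, hp, hS, hc⟩
    choose r hr hrp using fun t => Finset.mem_map.1 (hS t)
    obtain rfl : (fun t => f.prodMap f (r t)) = p := funext hrp
    exact ⟨k, r, hp.of_comp, hr, fun t => f.injective (hc t)⟩
  · rintro ⟨k, p, hp, hS, hc⟩
    exact ⟨k, fun t => f.prodMap f (p t), (f.prodMap f).injective.comp hp,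
      fun t => Finset.mem_map_of_mem _ (hS t), fun t => congrArg f (hc t)⟩

theorem admissible_empty : Admissible (∅ : Finset (Fin m × Fin m)) :=
  ⟨by simp, fun ⟨_, _, _, h, _⟩ => by simpa using h 0⟩

theorem admissible_map (f : Fin m ↪ Fin n) : Admissible (S.map (f.prodMap f)) ↔ Admissible S := by
  rw [Admissible, Admissible, hasCycle_map]
  refine and_congr_left fun _ => ?_
  simp only [Finset.forall_mem_map]
  refine forall₄_congr fun p _ p' _ => ?_
  rw [(f.prodMap f).injective.eq_iff]
  exact imp_congr_left f.injective.eq_iff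

theorem Admissible.mono (hT : Admissible T) (h : S ⊆ T) : Admissible S :=
  ⟨fun p hp p' hp' => hT.1 p (h hp) p' (h hp'),
    fun hS => hT.2 (hS.restrict fun _ hp _ _ _ => h hp)⟩

theorem Admissible.fst_ne_snd (hS : Admissible S) {p : Fin m × Fin m} (hp : p ∈ S) :
    p.1 ≠ p.2 := fun h =>
  hS.2 ⟨0, fun _ => p, fun _ _ _ => Subsingleton.elim (α := Fin 1) _ _, fun _ => hp,
    fun _ => h.symm⟩

theorem Admissible.card_le (hS : Admissible S) : S.card ≤ m - 1 := by
  classical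
  rcases m with _ | m
  · simp [Finset.eq_empty_of_isEmpty S]
  have hne : S.image Prod.snd ≠ Finset.univ := by
    intro h
    have hparent (j : Fin (m + 1)) : ∃ i, (i, j) ∈ S := by
      simpa using (h ▸ Finset.mem_univ j : j ∈ S.image Prod.snd)
    choose f hf using hparent
    exact hS.2 (hasCycle_of_forall_mem hf)
  calc S.card = (S.image Prod.snd).card :=
        (Finset.card_image_of_injOn fun p hp p' hp' => hS.1 p hp p' hp').symm
    _ ≤ m := by simpa [Nat.lt_succ_iff] using Finset.card_lt_card (Finset.ssubset_univ_iff.2 hne)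

/-- The product of the terms `C i j * X i` over the pairs `(i, j)` in `S`, that is, the term of the
forest polynomial that belongs to `S`. -/
def pairsWeight (C : Matrix (Fin m) (Fin m) ℕ) (S : Finset (Fin m × Fin m)) :
    MvPolynomial (Fin m) ℚ :=
  ∏ p ∈ S, MvPolynomial.C (C p.1 p.2 : ℚ) * MvPolynomial.X p.1

theorem pairsWeight_eq_monomial (C : Matrix (Fin m) (Fin m) ℕ) (S : Finset (Fin m × Fin m)) :
    pairsWeight C S =
      MvPolynomial.monomial (∑ p ∈ S, Finsupp.single p.1 1) (∏ p ∈ S, (C p.1 p.2 : ℚ)) := by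
  rw [MvPolynomial.monomial_sum_prod]
  exact Finset.prod_congr rfl fun p _ => MvPolynomial.C_mul_X_eq_monomial

theorem degree_sum_single_fst (S : Finset (Fin m × Fin m)) :
    (∑ p ∈ S, Finsupp.single p.1 1).degree = S.card := by
  simp [map_sum, Finsupp.degree_single]

open Classical in
theorem admissibleSets_eq_filter (m k : ℕ) :
    admissibleSets m k = {S ∈ ({S | Admissible S} : Finset (Finset (Fin m × Fin m))) |
      S.card = k} := by
  ext S
  simp [admissibleSets, Finset.mem_powersetCard, and_comm]

theorem admissibleSets_zero (m : ℕ) : admissibleSets m 0 = {∅} := by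
  ext S
  simp only [admissibleSets, Finset.powersetCard_zero, Finset.mem_filter, Finset.mem_singleton]
  exact and_iff_left_of_imp fun h => h ▸ admissible_empty

open Classical in
theorem forestPolynomial_eq_sum (C : Matrix (Fin m) (Fin m) ℕ) :
    forestPolynomial C = ∑ S with Admissible S, pairsWeight C S := by
  have hcard : ∀ S ∈ ({S | Admissible S} : Finset (Finset (Fin m × Fin m))),
      S.card ∈ insert 0 (Finset.Icc 1 (m - 1)) := by
    intro S hS
    have := (Finset.mem_filter.1 hS).2.card_le
    simp only [Finset.mem_insert, Finset.mem_Icc]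
    omega
  rw [← Finset.sum_fiberwise_of_maps_to hcard, Finset.sum_insert (by simp)]
  simp only [← admissibleSets_eq_filter, admissibleSets_zero, Finset.sum_singleton]
  simp [forestPolynomial, pairsWeight]

theorem totalDegree_forestPolynomial_le (C : Matrix (Fin m) (Fin m) ℕ) :
    (forestPolynomial C).totalDegree ≤ m - 1 := by
  classical
  rw [forestPolynomial_eq_sum]
  refine MvPolynomial.totalDegree_finsetSum_le fun S hS => ?_
  calc (pairsWeight C S).totalDegree ≤ (∑ p ∈ S, Finsupp.single p.1 1).degree := by
        rw [pairsWeight_eq_monomial]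
        exact MvPolynomial.totalDegree_monomial_le _ _
    _ ≤ m - 1 := by
        rw [degree_sum_single_fst]
        exact (Finset.mem_filter.1 hS).2.card_le

theorem forestPolynomial_congr {C D : Matrix (Fin m) (Fin m) ℕ}
    (h : ∀ i j, i ≠ j → C i j = D i j) : forestPolynomial C = forestPolynomial D := by
  classical
  rw [forestPolynomial_eq_sum, forestPolynomial_eq_sum]
  refine Finset.sum_congr rfl fun S hS => Finset.prod_congr rfl fun p hp => ?_
  rw [h _ _ ((Finset.mem_filter.1 hS).2.fst_ne_snd hp)]

theorem rename_forestPolynomial (C : Matrix (Fin m) (Fin m) ℕ) (σ : Equiv.Perm (Fin m)) :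
    MvPolynomial.rename σ (forestPolynomial (C.submatrix σ σ)) = forestPolynomial C := by
  classical
  rw [forestPolynomial_eq_sum, forestPolynomial_eq_sum, map_sum]
  refine Finset.sum_equiv (Equiv.prodCongr σ σ).finsetCongr (fun S => ?_) fun S _ => ?_
  · simp only [Finset.mem_filter, Finset.mem_univ, true_and]
    exact (admissible_map σ.toEmbedding).symm
  · simp [pairsWeight]

/-- The pairs `(i, j)` in `S`, viewed on the first `m` of `m + 1` vertices, together with the pair
`(i, m + 1)` if `o = some i`. These are the sets of pairs that contribute to the restriction of the
forest polynomial to `x_{m+1} = 0`. -/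
def extendPairs (S : Finset (Fin m × Fin m)) (o : Option (Fin m)) :
    Finset (Fin (m + 1) × Fin (m + 1)) :=
  S.map (Fin.castSuccEmb.prodMap Fin.castSuccEmb) ∪
    o.toFinset.map (Fin.castSuccEmb.trans (.sectL _ (Fin.last m)))

theorem mem_extendPairs_castSucc {o : Option (Fin m)} {i j : Fin m} :
    (i.castSucc, j.castSucc) ∈ extendPairs S o ↔ (i, j) ∈ S := by
  simp [extendPairs, (Fin.castSucc_lt_last _).ne']

theorem mem_extendPairs_last {o : Option (Fin m)} {i : Fin m} :
    (i.castSucc, Fin.last m) ∈ extendPairs S o ↔ i ∈ o := by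
  simp [extendPairs, (Fin.castSucc_lt_last _).ne, eq_comm]

theorem fst_ne_last_of_mem_extendPairs {o : Option (Fin m)} {p : Fin (m + 1) × Fin (m + 1)}
    (hp : p ∈ extendPairs S o) : p.1 ≠ Fin.last m := by
  simp only [extendPairs, Finset.mem_union, Finset.mem_map] at hp
  rcases hp with ⟨q, -, rfl⟩ | ⟨i, -, rfl⟩
  · exact (Fin.castSucc_lt_last _).ne
  · exact (Fin.castSucc_lt_last _).ne

theorem eq_extendPairs {T : Finset (Fin (m + 1) × Fin (m + 1))} {o : Option (Fin m)}
    (hT : ∀ p ∈ T, p.1 ≠ Fin.last m)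
    (hS : ∀ i j, (i.castSucc, j.castSucc) ∈ T ↔ (i, j) ∈ S)
    (ho : ∀ i : Fin m, (i.castSucc, Fin.last m) ∈ T ↔ i ∈ o) : T = extendPairs S o := by
  ext ⟨a, b⟩
  induction a using Fin.lastCases with
  | last => exact iff_of_false (fun h => hT _ h rfl) fun h => fst_ne_last_of_mem_extendPairs h rfl
  | cast i =>
    induction b using Fin.lastCases with
    | last => rw [mem_extendPairs_last, ho]
    | cast j => rw [mem_extendPairs_castSucc, hS]

theorem extendPairs_injective :
    Function.Injective fun x : Finset (Fin m × Fin m) × Option (Fin m) =>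
      extendPairs x.1 x.2 := by
  rintro ⟨S, o⟩ ⟨T, o'⟩ h
  have hmem (p) : p ∈ extendPairs S o ↔ p ∈ extendPairs T o' := iff_of_eq (congrArg (p ∈ ·) h)
  refine Prod.ext (Finset.ext fun p => ?_) (Option.ext fun i => ?_)
  · simpa only [mem_extendPairs_castSucc] using hmem (p.1.castSucc, p.2.castSucc)
  · exact mem_extendPairs_last.symm.trans
      ((hmem (i.castSucc, Fin.last m)).trans mem_extendPairs_last)

theorem admissible_extendPairs (hS : Admissible S) (o : Option (Fin m)) :
    Admissible (extendPairs S o) := by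
  have hS' := (admissible_map Fin.castSuccEmb).2 hS
  have hmem {p} (hp : p ∈ extendPairs S o) (hlast : p.2 ≠ Fin.last m) :
      p ∈ S.map (Fin.castSuccEmb.prodMap Fin.castSuccEmb) := by
    refine (Finset.mem_union.1 hp).resolve_right fun h => ?_
    obtain ⟨i, -, rfl⟩ := Finset.mem_map.1 h
    exact hlast rfl
  constructor
  · rintro ⟨a, b⟩ hp ⟨a', b'⟩ hp' (rfl : b = b')
    rcases eq_or_ne b (Fin.last m) with rfl | hb
    · obtain ⟨i, rfl⟩ := Fin.exists_castSucc_eq.2 (fst_ne_last_of_mem_extendPairs hp)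
      obtain ⟨i', rfl⟩ := Fin.exists_castSucc_eq.2 (fst_ne_last_of_mem_extendPairs hp')
      rw [Option.mem_unique (mem_extendPairs_last.1 hp) (mem_extendPairs_last.1 hp')]
    · exact hS'.1 _ (hmem hp hb) _ (hmem hp' hb) rfl
  · exact fun h => hS'.2 (h.restrict fun p hp p' hp' hpp' =>
      hmem hp (hpp' ▸ fst_ne_last_of_mem_extendPairs hp'))

theorem exists_extendPairs_eq {T : Finset (Fin (m + 1) × Fin (m + 1))} (hT : Admissible T)
    (hlast : ∀ p ∈ T, p.1 ≠ Fin.last m) :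
    ∃ S : Finset (Fin m × Fin m), Admissible S ∧ ∃ o, extendPairs S o = T := by
  classical
  set S : Finset (Fin m × Fin m) := {p | (p.1.castSucc, p.2.castSucc) ∈ T}
  have hS : Admissible S := by
    refine (admissible_map Fin.castSuccEmb).1 (hT.mono fun p hp => ?_)
    obtain ⟨r, hr, rfl⟩ := Finset.mem_map.1 hp
    exact (Finset.mem_filter.1 hr).2
  obtain ⟨o, ho⟩ : ∃ o : Option (Fin m), ∀ i, (i.castSucc, Fin.last m) ∈ T ↔ i ∈ o := by
    by_cases h : ∃ i : Fin m, (i.castSucc, Fin.last m) ∈ T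
    · obtain ⟨i, hi⟩ := h
      refine ⟨some i, fun j => ⟨fun hj => ?_, fun hj => ?_⟩⟩
      · exact congrArg some (Fin.castSucc_injective m (congrArg Prod.fst (hT.1 _ hi _ hj rfl)))
      · rwa [← Option.mem_some_iff.1 hj]
    · exact ⟨none, fun j => by simpa using fun hj => h ⟨j, hj⟩⟩
  exact ⟨S, hS, o, (eq_extendPairs hlast (fun i j => by simp [S]) ho).symm⟩

theorem aeval_snoc_pairsWeight_extendPairs (C : Matrix (Fin (m + 1)) (Fin (m + 1)) ℕ)
    (S : Finset (Fin m × Fin m)) (o : Option (Fin m)) :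
    MvPolynomial.aeval (Fin.snoc (α := fun _ => MvPolynomial (Fin m) ℚ) MvPolynomial.X 0)
        (pairsWeight C (extendPairs S o)) =
      pairsWeight (C.submatrix Fin.castSucc Fin.castSucc) S *
        o.elim 1 fun i =>
          MvPolynomial.C (C i.castSucc (Fin.last m) : ℚ) * MvPolynomial.X i := by
  have hdisj : Disjoint (S.map (Fin.castSuccEmb.prodMap Fin.castSuccEmb))
      (o.toFinset.map (Fin.castSuccEmb.trans (.sectL _ (Fin.last m)))) := by
    simp only [Finset.disjoint_left, Finset.mem_map]
    rintro _ ⟨p, -, rfl⟩ ⟨i, -, hi⟩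
    exact (Fin.castSucc_lt_last p.2).ne' (congrArg Prod.snd hi)
  rw [pairsWeight, extendPairs, Finset.prod_union hdisj]
  cases o <;> simp [pairsWeight]

theorem aeval_snoc_pairsWeight_eq_zero (C : Matrix (Fin (m + 1)) (Fin (m + 1)) ℕ)
    {T : Finset (Fin (m + 1) × Fin (m + 1))} {p : Fin (m + 1) × Fin (m + 1)} (hp : p ∈ T)
    (hlast : p.1 = Fin.last m) :
    MvPolynomial.aeval (Fin.snoc (α := fun _ => MvPolynomial (Fin m) ℚ) MvPolynomial.X 0)
      (pairsWeight C T) = 0 := by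
  rw [pairsWeight, map_prod]
  exact Finset.prod_eq_zero hp (by simp [hlast])

theorem aeval_snoc_forestPolynomial (C : Matrix (Fin (m + 1)) (Fin (m + 1)) ℕ) :
    MvPolynomial.aeval (Fin.snoc (α := fun _ => MvPolynomial (Fin m) ℚ) MvPolynomial.X 0)
        (forestPolynomial C) =
      forestPolynomial (C.submatrix Fin.castSucc Fin.castSucc) *
        (1 + ∑ i : Fin m,
          MvPolynomial.C (C i.castSucc (Fin.last m) : ℚ) * MvPolynomial.X i) := by
  classical
  have hoption : (1 : MvPolynomial (Fin m) ℚ) + ∑ i : Fin m,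
      MvPolynomial.C (C i.castSucc (Fin.last m) : ℚ) * MvPolynomial.X i =
      ∑ o : Option (Fin m), o.elim 1 fun i =>
        MvPolynomial.C (C i.castSucc (Fin.last m) : ℚ) * MvPolynomial.X i := by
    rw [Fintype.sum_option]
    rfl
  rw [forestPolynomial_eq_sum, forestPolynomial_eq_sum, map_sum, hoption, Finset.sum_mul_sum,
    ← Finset.sum_product']
  refine (Finset.sum_of_injOn _ extendPairs_injective.injOn ?_ ?_ ?_).symm
  · rintro ⟨S, o⟩ hS
    simp only [Finset.coe_product, Set.mem_prod, Finset.mem_coe, Finset.mem_filter,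
      Finset.mem_univ, true_and] at hS
    simpa using admissible_extendPairs hS.1 o
  · intro T hT hT'
    by_cases h : ∀ p ∈ T, p.1 ≠ Fin.last m
    · obtain ⟨S, hS, o, rfl⟩ := exists_extendPairs_eq (Finset.mem_filter.1 hT).2 h
      exact absurd ⟨(S, o), by simpa using hS, rfl⟩ hT'
    · push Not at h
      obtain ⟨p, hp, hlast⟩ := h
      exact aeval_snoc_pairsWeight_eq_zero C hp hlast
  · rintro ⟨S, o⟩ -
    exact (aeval_snoc_pairsWeight_extendPairs C S o).symm

theorem forestPolynomial_satisfiesAxioms : SatisfiesAxioms fun _ C => forestPolynomial C where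
  A0 C := by simp [forestPolynomial]
  A1 _ _ C _ σ := rename_forestPolynomial C σ
  A2 _ _ C _ := aeval_snoc_forestPolynomial C

theorem forestDet_satisfiesAxioms :
    SatisfiesAxioms fun _ C => forestDet (C.map (Nat.cast : ℕ → ℚ)) where
  A0 C := by simp [forestDet, forestMatrix_apply]
  A1 _ _ C _ σ := rename_forestDet (C.map (Nat.cast : ℕ → ℚ)) σ
  A2 _ _ C _ := by
    rw [aeval_forestDet, det_forestMatrix_snoc]
    rfl

theorem forestPolynomial_eq_forestDet {C : Matrix (Fin m) (Fin m) ℕ} (hC : C.IsSymm) :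
    forestPolynomial C = forestDet (C.map (Nat.cast : ℕ → ℚ)) := by
  rcases Nat.eq_zero_or_pos m with rfl | hm
  · simp [forestPolynomial, forestDet]
  · refine forestPolynomial_satisfiesAxioms.unique forestDet_satisfiesAxioms
      (fun _ C _ _ => totalDegree_forestPolynomial_le C) (fun k C hk _ => ?_) m C hm hC
    have : Nonempty (Fin k) := ⟨⟨0, hk⟩⟩
    simpa using totalDegree_forestDet_le (C.map (Nat.cast : ℕ → ℚ))

theorem limitCoeff_one {C : Matrix (Fin m) (Fin m) ℕ} (hC : C.IsSymm) (l : Fin m → ℕ) :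
    limitCoeff C 1 l = (-1) ^ (∑ i, (C i i + 1) * l i)
      * MvPolynomial.eval (fun i => (l i : ℚ)) (forestPolynomial C)
      * ∏ j, (1 / (1 + ∑ i, (C i j : ℚ) * (l i : ℚ)))
          * ((1 + ∑ i, C i j * l i).choose (l j) : ℚ) := by
  have hx (j : Fin m) : ((1 + l ᵥ* C) j : ℚ) ≠ 0 := by
    simp only [Pi.add_apply, Pi.one_apply]
    positivity
  have hsum (j : Fin m) : (1 + l ᵥ* C) j = 1 + ∑ i, C i j * l i := by
    simp [Matrix.vecMul, dotProduct, mul_comm]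
  have hmatrix : Matrix.diagonal (fun j => ((1 + l ᵥ* C) j : ℚ)) -
      C.map (Nat.cast : ℕ → ℚ) * Matrix.diagonal (fun j => (l j : ℚ)) =
        (forestMatrix (C.map (Nat.cast : ℕ → ℚ)) fun i => (l i : ℚ))ᵀ := by
    rw [transpose_forestMatrix (hC.map _), ← natCast_vecMul]
    congr 2
    ext j
    simp
  rw [limitCoeff, det_binomialMatrix_of_ne_zero _ hx, hmatrix, Matrix.det_transpose,
    forestPolynomial_eq_forestDet hC, eval_forestDet, ← mul_assoc]
  simp only [Ring.choose_natCast, hsum]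
  push_cast
  rfl

theorem exists_adj_dist_lt {V : Type*} {G : SimpleGraph V} {u v : V} (h : G.Reachable u v)
    (huv : u ≠ v) : ∃ w, G.Adj u w ∧ G.dist w v < G.dist u v := by
  obtain ⟨p, hp⟩ := h.exists_walk_length_eq_dist
  cases p with
  | nil => exact absurd rfl huv
  | @cons _ w _ huw p =>
    refine ⟨w, huw, ?_⟩
    calc G.dist w v ≤ p.length := SimpleGraph.dist_le p
      _ < G.dist u v := by rw [← hp, SimpleGraph.Walk.length_cons]; exact Nat.lt_succ_self _

theorem underlyingGraph_adj {C : Matrix (Fin m) (Fin m) ℕ} (hC : C.IsSymm) {i j : Fin m} :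
    (underlyingGraph C).Adj i j ↔ i ≠ j ∧ C i j ≠ 0 := by
  rw [underlyingGraph, SimpleGraph.fromRel_adj, hC.apply i j, or_self]

theorem exists_admissible_of_connected {C : Matrix (Fin m) (Fin m) ℕ} (hC : C.IsSymm)
    (h : (underlyingGraph C).Connected) :
    ∃ S : Finset (Fin m × Fin m), Admissible S ∧ S.card = m - 1 ∧ ∀ p ∈ S, C p.1 p.2 ≠ 0 := by
  classical
  obtain ⟨r⟩ := h.nonempty
  have hparent (j : Fin m) : ∃ i, j ≠ r → (underlyingGraph C).Adj j i ∧
      (underlyingGraph C).dist i r < (underlyingGraph C).dist j r := by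
    by_cases hj : j = r
    · exact ⟨r, absurd hj⟩
    · exact (exists_adj_dist_lt (h j r) hj).imp fun i hi _ => hi
  choose parent hparent using hparent
  have hmem {p} (hp : p ∈ ({r}ᶜ : Finset (Fin m)).image fun j => (parent j, j)) :
      p.1 = parent p.2 ∧ p.2 ≠ r := by
    obtain ⟨j, hj, rfl⟩ := Finset.mem_image.1 hp
    exact ⟨rfl, by simpa using hj⟩
  refine ⟨({r}ᶜ : Finset (Fin m)).image fun j => (parent j, j), ⟨fun p hp p' hp' h => ?_, ?_⟩, ?_,
    fun p hp => ?_⟩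
  · exact Prod.ext (by rw [(hmem hp).1, (hmem hp').1, h]) h
  · refine not_hasCycle_of_lt (fun j => (underlyingGraph C).dist j r) fun p hp => ?_
    rw [(hmem hp).1]
    exact (hparent p.2 (hmem hp).2).2
  · rw [Finset.card_image_of_injective _ fun _ _ h => congrArg Prod.snd h]
    simp [Finset.card_compl]
  · rw [(hmem hp).1]
    exact ((underlyingGraph_adj hC).1 (hparent p.2 (hmem hp).2).1.symm).2

theorem coeff_forestPolynomial_pos {C : Matrix (Fin m) (Fin m) ℕ} (hS : Admissible S)
    (hC : ∀ p ∈ S, C p.1 p.2 ≠ 0) :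
    0 < (forestPolynomial C).coeff (∑ p ∈ S, Finsupp.single p.1 1) := by
  classical
  simp only [forestPolynomial_eq_sum, MvPolynomial.coeff_sum, pairsWeight_eq_monomial,
    MvPolynomial.coeff_monomial]
  refine Finset.sum_pos' (fun T _ => ?_) ⟨S, by simpa using hS, ?_⟩
  · split_ifs <;> positivity
  · rw [if_pos rfl]
    exact Finset.prod_pos fun p hp => Nat.cast_pos.2 (Nat.pos_of_ne_zero (hC p hp))

theorem totalDegree_forestPolynomial_of_connected {C : Matrix (Fin m) (Fin m) ℕ} (hC : C.IsSymm)
    (h : (underlyingGraph C).Connected) : (forestPolynomial C).totalDegree = m - 1 := by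
  obtain ⟨S, hS, hcard, hne⟩ := exists_admissible_of_connected hC h
  refine (totalDegree_forestPolynomial_le C).antisymm ?_
  calc m - 1 = (∑ p ∈ S, Finsupp.single p.1 1).degree := by rw [degree_sum_single_fst, hcard]
    _ ≤ (forestPolynomial C).totalDegree := MvPolynomial.le_totalDegree
        (MvPolynomial.mem_support_iff.2 (coeff_forestPolynomial_pos hS hne).ne')

end AdmissibleSets

end

end SymmetricQuiver

open SymmetricQuiver in
theorem mainTheorem1 :
    -- the classical limit exists coefficientwise and is given by the explicit formula
    (∀ (m : ℕ) (C : Matrix (Fin m) (Fin m) ℕ), C.IsSymm → ∀ l : Fin m →₀ ℕ,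
      Tendsto (fun q : ℝ => MvPowerSeries.coeff l (seriesRatio C q)) (𝓝[≠] 1)
        (𝓝 (((-1) ^ (∑ i, (C i i + 1) * l i)
            * MvPolynomial.eval (fun i => (l i : ℚ)) (forestPolynomial C)
            * ∏ j, (1 / (1 + ∑ i, (C i j : ℚ) * (l i : ℚ)))
                * ((1 + ∑ i, C i j * l i).choose (l j) : ℚ) : ℚ) : ℝ))) ∧
    -- `A` has degree at most `m - 1`, with equality when the quiver is connected
    (∀ (m : ℕ) (C : Matrix (Fin m) (Fin m) ℕ), C.IsSymm →
      (forestPolynomial C).totalDegree ≤ m - 1 ∧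
      ((underlyingGraph C).Connected → (forestPolynomial C).totalDegree = m - 1)) ∧
    -- the coefficients of `A` depend only on the off-diagonal entries of the matrix
    (∀ (m : ℕ) (C D : Matrix (Fin m) (Fin m) ℕ), C.IsSymm → D.IsSymm →
      (∀ i j, i ≠ j → C i j = D i j) → forestPolynomial C = forestPolynomial D) ∧
    -- `A` satisfies (A0), (A1), (A2)
    SatisfiesAxioms (fun _ C => forestPolynomial C) ∧
    -- and is the only such family of polynomials of degree at most `m - 1`
    (∀ P : ∀ m : ℕ, Matrix (Fin m) (Fin m) ℕ → MvPolynomial (Fin m) ℚ,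
      SatisfiesAxioms P →
      (∀ (m : ℕ) (C : Matrix (Fin m) (Fin m) ℕ), 1 ≤ m → C.IsSymm →
        (P m C).totalDegree ≤ m - 1) →
      ∀ (m : ℕ) (C : Matrix (Fin m) (Fin m) ℕ), 1 ≤ m → C.IsSymm →
        P m C = forestPolynomial C) := by
  refine ⟨fun m C hC l => ?_, fun m C hC => ⟨totalDegree_forestPolynomial_le C,
    totalDegree_forestPolynomial_of_connected hC⟩, fun m C D _ _ => forestPolynomial_congr,
    forestPolynomial_satisfiesAxioms, fun P hP hdeg m C hm hC => ?_⟩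
  · rw [← limitCoeff_one hC l]
    simpa only [shiftedRatio_one] using tendsto_coeff_shiftedRatio hC 1 l
  · exact hP.unique forestPolynomial_satisfiesAxioms hdeg
      (fun _ C _ _ => totalDegree_forestPolynomial_le C) m C hm hC
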